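/- Fix an integer $m\ge 1$ and let $G_n=G_n^m$ be the preferential attachment multigraph: $G_1$ is a single node $1$ with $m$ self-loops; $G_t$ is obtained from $G_{t-1}$ by adding the node $t$ together with $m$ edges $(t,v_1),\dots,(t,v_m)$ inserted one after the other, where, if $M$ denotes the sum of the degrees of all nodes (including $t$) just before an edge is inserted, its endpoint is a node $v<t$ with probability $\deg(v)/(M+1)$ and is $t$ itself with probability $(\deg(t)+1)/(M+1)$ (degrees are the current ones; a self-loop counts twice). Then, with probability tending to $1$ as $n\to\infty$, the random sequence of graphs $G_1\subseteq\dots\subseteq G_n$ is such that the following holds simultaneously for all nodes $u\in\{1,\dots,n\}$ and all arrival times $i\in\{2,\dots,n\}$ with $i\neq u$: the conditional probability, given the graph $G_{\max\{u,i\}-1}$ present just before the later of the two nodes $u$ and $i$ arrives, that $u$ is adjacent to the node $i$ arriving at time $i$ is at most $$\frac{\max\{d,\log^3 n\}}{i-1}.$$ Here $\log$ is the natural logarithm and $d$ is the degree of $u$ in $G_s$, for any time $s$ with $\max\{u,i-1\}\le s\le n$; in particular $d$ may be taken to be the final degree of $u$ in $G_n$, or, if $i$ arrives after $u$, the degree of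 $u$ just before $i$ arrives. -/

import Mathlib

open Filter Topology MeasureTheory ProbabilityTheory
open scoped ENNReal

noncomputable section

/-- Multigraphs (loops and parallel edges allowed) on nodes labelled `1, 2, 3, …` in their order
of arrival, given by their multiset of edges. An edge is stored as `(new node, chosen endpoint)`. -/
abbrev PAGraph := Multiset (ℕ × ℕ)

instance instMeasurableSpacePAGraph : MeasurableSpace PAGraph := ⊤

namespace PAGraph

/-- The degree of the node `v`; a loop counts twice. -/
def deg (G : PAGraph) (v : ℕ) : ℕ :=
  (G.map Prod.fst).count v + (G.map Prod.snd).count v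

/-- Some edge joins `u` and `v`. -/
def Adjacent (G : PAGraph) (u v : ℕ) : Prop :=
  (u, v) ∈ G ∨ (v, u) ∈ G

/-- The subgraph induced on the nodes `1, …, t`. For a graph grown by preferential attachment this
is the graph as it was after `t` steps, since the edges inserted with node `k` join `k` to nodes
`v ≤ k`. -/
def upTo (G : PAGraph) (t : ℕ) : PAGraph :=
  G.filter (fun e => e.1 ≤ t ∧ e.2 ≤ t)

/-- The sum of the degrees of the nodes `1, …, u`. -/
def totalDeg (u : ℕ) (G : PAGraph) : ℕ :=
  ∑ v ∈ Finset.Icc 1 u, G.deg v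

/-- The probability with which `v` is selected as the endpoint of the next edge of the newest
node `u`: it is `deg v / (M + 1)` for `v < u` and `(deg u + 1) / (M + 1)` for `v = u`. -/
def endpointProb (u : ℕ) (G : PAGraph) (v : ℕ) : ℝ≥0∞ :=
  if v ∈ Finset.Icc 1 u then
    ((G.deg v + if v = u then 1 else 0 : ℕ) : ℝ≥0∞) / ((totalDeg u G + 1 : ℕ) : ℝ≥0∞)
  else 0

theorem sum_endpointProb (u : ℕ) (hu : 1 ≤ u) (G : PAGraph) :
    ∑ v ∈ Finset.Icc 1 u, endpointProb u G v = 1 := by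
  have h : ∑ v ∈ Finset.Icc 1 u, (G.deg v + if v = u then 1 else 0) = totalDeg u G + 1 := by
    rw [Finset.sum_add_distrib, Finset.sum_ite_eq', if_pos (Finset.mem_Icc.2 ⟨hu, le_rfl⟩)]
    rfl
  have h2 : ∀ v ∈ Finset.Icc 1 u, endpointProb u G v
      = ((G.deg v + if v = u then 1 else 0 : ℕ) : ℝ≥0∞) * ((totalDeg u G + 1 : ℕ) : ℝ≥0∞)⁻¹ := by
    intro v hv
    rw [endpointProb, if_pos hv, div_eq_mul_inv]
  rw [Finset.sum_congr rfl h2, ← Finset.sum_mul, ← Nat.cast_sum, h]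
  exact ENNReal.mul_inv_cancel (Nat.cast_ne_zero.2 (Nat.succ_ne_zero _)) (ENNReal.natCast_ne_top _)

/-- The random endpoint of the next edge of the newest node `u`. -/
def endpoint (u : ℕ) (hu : 1 ≤ u) (G : PAGraph) : PMF ℕ :=
  PMF.ofFinset (endpointProb u G) (Finset.Icc 1 u) (sum_endpointProb u hu G)
    (fun _ hv => if_neg hv)

/-- Insert `k` edges at the newest node `u`, one after the other. -/
def addEdges (u : ℕ) (hu : 1 ≤ u) : ℕ → PAGraph → PMF PAGraph
  | 0, G => PMF.pure G
  | k + 1, G => (endpoint u hu G).bind fun v => addEdges u hu k ((u, v) ::ₘ G)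

/-- The law of the preferential attachment graph `G_n^m`. (For `n = 0`: the empty graph.) -/
def law (m : ℕ) : ℕ → PMF PAGraph
  | 0 => PMF.pure 0
  | 1 => PMF.pure (Multiset.replicate m (1, 1))
  | n + 2 => (law m (n + 1)).bind fun G => addEdges (n + 2) (Nat.le_add_left 1 (n + 1)) m G

/-- Let `t = max u i` be the time at which the later of the two nodes `u`, `i` arrives. This is the
conditional probability, in the random graph `G_n^m`, that `u` and `i` are adjacent, given that
after `t - 1` steps (just before the later of them arrives) the graph was the one that `G` was. -/
def arrivalProb (m n : ℕ) (G : PAGraph) (u i : ℕ) : ℝ :=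
  (cond (law m n).toMeasure {H | H.upTo (max u i - 1) = G.upTo (max u i - 1)}).real
    {H | H.Adjacent u i}

end PAGraph

end

/-!
Let `X` be the degree of a fixed older node and `c` the number of edges present. The next edge
raises `X` by one with probability `X / (2c + 1)`, and the rising factorial `X⁽ᵏ⁾` satisfies
`X ((X + 1)⁽ᵏ⁾ - X⁽ᵏ⁾) = k X⁽ᵏ⁾`. Hence inserting the edge multiplies the expectation of `X⁽ᵏ⁾`
exactly by `1 + k / (2c + 1) ≤ ((c + 1) / c)ᵏ`, a product that telescopes over the edges.

For `k = 1` this bounds the expected growth of the degree of `u` when node `t + 1` arrives. As that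
degree grows by at least one whenever the two nodes become adjacent, the conditional probability of
adjacency is at most `deg u / t`. Degrees only increase, so this settles the case in which `i`
arrives after `u`.

If `u` arrives after `i`, the same bound involves the degree of `i` at time `t = u - 1` instead.
Telescoping from the arrival of `i` on, the `k`-th rising factorial moment of this degree is at most
`(2m)⁽ᵏ⁾ (t / i)ᵏ`. With `k = ⌈log n⌉`, Markov's inequality and a union bound show that, outside an
event of probability at most `1 / n`, all degrees are at most `t / i` times `2 e³ log n`; dividing
by `t` leaves `2 e³ log n / i`.
-/

section Probability

variable {α β : Type*}

theorem map_congr_of_mem_support {p : PMF α} {f g : α → β} (h : ∀ a ∈ p.support, f a = g a) :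
    p.map f = p.map g := by
  ext b
  rw [PMF.map_apply, PMF.map_apply]
  refine tsum_congr fun a => ?_
  by_cases ha : a ∈ p.support
  · rw [h a ha]
  · simp [(p.apply_eq_zero_iff a).2 ha]

variable [MeasurableSpace α] [MeasurableSpace β]

theorem cond_preimage_apply (μ : Measure α) {f : α → β} (hf : Measurable f) {s t : Set β}
    (hs : MeasurableSet s) (ht : MeasurableSet t) :
    μ[f ⁻¹' t | f ⁻¹' s] = (μ.map f)[t | s] := by
  rw [cond_apply (hf hs), cond_apply hs, Measure.map_apply hf hs,
    Measure.map_apply hf (hs.inter ht), Set.preimage_inter]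

variable [DiscreteMeasurableSpace α]

theorem ae_toMeasure_mem_support (p : PMF α) : ∀ᵐ a ∂p.toMeasure, a ∈ p.support :=
  (p.toMeasure_apply_eq_zero_iff .of_discrete).2 disjoint_compl_right

theorem lintegral_toMeasure [Countable α] (p : PMF α) (f : α → ℝ≥0∞) :
    ∫⁻ a, f a ∂p.toMeasure = ∑' a, p a * f a := by
  simp_rw [lintegral_countable', p.toMeasure_apply_singleton _ .of_discrete, mul_comm]

theorem cond_toMeasure_bind {ι : Type*} {p : PMF ι} {q : ι → PMF α} {r : α → ι}
    (hr : ∀ i ∈ p.support, ∀ a ∈ (q i).support, r a = i) {i : ι} (hi : i ∈ p.support) :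
    (p.bind q).toMeasure[|r ⁻¹' {i}] = (q i).toMeasure := by
  have joint (s : Set α) : (p.bind q).toMeasure (r ⁻¹' {i} ∩ s) = p i * (q i).toMeasure s := by
    rw [PMF.toMeasure_bind_apply _ _ _ .of_discrete, tsum_eq_single i]
    · congr 1
      refine PMF.toMeasure_apply_eq_of_inter_support_eq _ .of_discrete .of_discrete ?_
      ext a
      simp +contextual [hr i hi]
    · intro j hj
      by_cases hp : j ∈ p.support
      · rw [(PMF.toMeasure_apply_eq_zero_iff _ .of_discrete).2, mul_zero]
        refine Set.disjoint_left.2 fun a ha has => hj ?_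
        exact (hr j hp a ha).symm.trans has.1
      · rw [(p.apply_eq_zero_iff j).2 hp, zero_mul]
  have first : (p.bind q).toMeasure (r ⁻¹' {i}) = p i := by
    simpa using joint Set.univ
  ext s
  rw [cond_apply .of_discrete, joint, first, ← mul_assoc,
    ENNReal.inv_mul_cancel ((p.mem_support_iff i).1 hi) (p.apply_ne_top i), one_mul]

variable [DiscreteMeasurableSpace β]

theorem lintegral_toMeasure_bind [Countable α] [Countable β] (p : PMF α) (q : α → PMF β)
    (f : β → ℝ≥0∞) :
    ∫⁻ b, f b ∂(p.bind q).toMeasure = ∫⁻ a, ∫⁻ b, f b ∂(q a).toMeasure ∂p.toMeasure := by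
  simp_rw [lintegral_toMeasure, PMF.bind_apply, ← ENNReal.tsum_mul_right, ← ENNReal.tsum_mul_left]
  rw [ENNReal.tsum_comm]
  simp_rw [mul_assoc]

end Probability

theorem exists_ascFactorial_add_one_eq (x k : ℕ) :
    ∃ d, (x + 1).ascFactorial k = x.ascFactorial k + d ∧ x * d = k * x.ascFactorial k := by
  obtain ⟨d, hd⟩ := Nat.exists_eq_add_of_le (Nat.ascFactorial_le k x.le_succ)
  have hstep := Nat.succ_ascFactorial x k
  rw [hd] at hstep
  exact ⟨d, hd, by linarith⟩

theorem one_add_div_le_pow (c k : ℕ) :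
    1 + (k : ℝ≥0∞) / (2 * c + 1 : ℕ) ≤ (((c + 1 : ℕ) : ℝ≥0∞) / c) ^ k :=
  calc
    1 + (k : ℝ≥0∞) / (2 * c + 1 : ℕ) ≤ 1 + k * (c : ℝ≥0∞)⁻¹ := by
      rw [div_eq_mul_inv]
      gcongr
      omega
    _ ≤ (1 + (c : ℝ≥0∞)⁻¹) ^ k := one_add_mul_le_pow_of_sq_nonneg zero_le zero_le zero_le k
    _ ≤ (((c + 1 : ℕ) : ℝ≥0∞) / c) ^ k := by
      gcongr
      rw [Nat.cast_add_one, ENNReal.add_div, one_div]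
      rcases eq_or_ne c 0 with rfl | hc
      · simp
      · rw [ENNReal.div_self (by simpa) (by simp)]

theorem natCast_mul_div_mul_left_le (m a c : ℕ) :
    ((m * a : ℕ) : ℝ≥0∞) / (m * c : ℕ) ≤ a / c := by
  rcases eq_or_ne m 0 with rfl | hm
  · simp
  · rw [Nat.cast_mul, Nat.cast_mul, ENNReal.mul_div_mul_left _ _ (by simpa) (by simp)]

theorem div_mul_div_cancel_natCast {a b c : ℕ} (hb : b ≠ 0) :
    (a : ℝ≥0∞) / b * (b / c) = a / c := by
  rw [← mul_div_assoc, ENNReal.div_mul_cancel (by simpa) (by simp)]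

theorem tendsto_log_natCast_atTop : Tendsto (fun n : ℕ => Real.log n) atTop atTop :=
  Real.tendsto_log_atTop.comp tendsto_natCast_atTop_atTop

theorem eventually_mul_log_le_log_pow_three (C : ℝ) :
    ∀ᶠ n : ℕ in atTop, C * Real.log n ≤ Real.log n ^ 3 := by
  filter_upwards [tendsto_log_natCast_atTop.eventually_ge_atTop (max 1 C)] with n hn
  have hone : 1 ≤ Real.log n := (le_max_left _ _).trans hn
  calc
    C * Real.log n ≤ Real.log n * Real.log n := by
      gcongr
      exact (le_max_right _ _).trans hn
    _ = Real.log n ^ 2 := (sq _).symm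
    _ ≤ Real.log n ^ 3 := pow_le_pow_right₀ hone (by norm_num)

theorem pow_ceil_log_le_rpow_neg {x r c : ℝ} (hx : 0 < x) (hr : 0 ≤ r) (hc : 0 ≤ c)
    (hrc : r ≤ Real.exp (-c)) : r ^ ⌈Real.log x⌉₊ ≤ x ^ (-c) :=
  calc
    r ^ ⌈Real.log x⌉₊ ≤ Real.exp (-c) ^ ⌈Real.log x⌉₊ := by gcongr
    _ = Real.exp (-(⌈Real.log x⌉₊ * c)) := by rw [← Real.exp_nat_mul, mul_neg]
    _ ≤ Real.exp (-(Real.log x * c)) := by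
      gcongr
      exact Nat.le_ceil _
    _ = x ^ (-c) := by rw [Real.rpow_def_of_pos hx, mul_neg]

namespace PAGraph

instance instDiscreteMeasurableSpace : DiscreteMeasurableSpace PAGraph := ⟨fun _ => trivial⟩

theorem adjacent_comm (G : PAGraph) (u v : ℕ) : G.Adjacent u v ↔ G.Adjacent v u := or_comm

theorem deg_mono {G H : PAGraph} (h : G ≤ H) (a : ℕ) : G.deg a ≤ H.deg a :=
  add_le_add (Multiset.count_le_of_le _ (Multiset.map_le_map h))
    (Multiset.count_le_of_le _ (Multiset.map_le_map h))

theorem deg_add (G H : PAGraph) (a : ℕ) : (G + H).deg a = G.deg a + H.deg a := by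
  simp only [deg, Multiset.map_add, Multiset.count_add]
  omega

theorem deg_le_two_mul_card (G : PAGraph) (a : ℕ) : G.deg a ≤ 2 * Multiset.card G := by
  have hfst := Multiset.count_le_card a (G.map Prod.fst)
  have hsnd := Multiset.count_le_card a (G.map Prod.snd)
  rw [Multiset.card_map] at hfst hsnd
  rw [deg]
  omega

theorem deg_map_mk_of_ne {u a : ℕ} (h : u ≠ a) (S : Multiset ℕ) :
    deg (S.map (Prod.mk u)) a = S.count a := by
  simp [deg, Multiset.map_map, Multiset.count_replicate, h]

theorem deg_cons_of_ne {u a : ℕ} (h : u ≠ a) (v : ℕ) (G : PAGraph) :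
    deg ((u, v) ::ₘ G) a = G.deg a + if v = a then 1 else 0 := by
  simp [deg, h.symm, Multiset.count_cons, eq_comm, add_assoc]

theorem upTo_mono (G : PAGraph) : Monotone G.upTo := fun _ _ h =>
  Multiset.monotone_filter_right _ fun _ he => ⟨he.1.trans h, he.2.trans h⟩

theorem upTo_upTo (G : PAGraph) {s t : ℕ} (h : s ≤ t) : (G.upTo t).upTo s = G.upTo s := by
  rw [upTo, upTo, upTo, Multiset.filter_filter]
  refine Multiset.filter_congr fun e _ => ?_
  omega

theorem upTo_cons_of_lt {u t : ℕ} (h : t < u) (v : ℕ) (G : PAGraph) :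
    upTo ((u, v) ::ₘ G) t = G.upTo t :=
  Multiset.filter_cons_of_neg _ fun he => h.not_ge he.1

theorem adjacent_upTo (G : PAGraph) {u v t : ℕ} (hu : u ≤ t) (hv : v ≤ t) :
    (G.upTo t).Adjacent u v ↔ G.Adjacent u v := by
  simp [Adjacent, upTo, hu, hv]

/-- The nodes of `G` that are incident to an edge are among `1, …, t`. The graph after `t` steps of
preferential attachment has this property. -/
def SupportedOn (t : ℕ) (G : PAGraph) : Prop :=
  ∀ e ∈ G, e.1 ∈ Finset.Icc 1 t ∧ e.2 ∈ Finset.Icc 1 t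

namespace SupportedOn

variable {s t u v a : ℕ} {G : PAGraph}

theorem mono (h : G.SupportedOn s) (hst : s ≤ t) : G.SupportedOn t := fun e he =>
  have hsub := Finset.Icc_subset_Icc_right hst
  ⟨hsub (h e he).1, hsub (h e he).2⟩

theorem cons (h : G.SupportedOn t) (hu : u ∈ Finset.Icc 1 t) (hv : v ∈ Finset.Icc 1 t) :
    SupportedOn t ((u, v) ::ₘ G) := by
  intro e he
  rcases Multiset.mem_cons.1 he with rfl | he
  · exact ⟨hu, hv⟩
  · exact h e he

theorem upTo_eq (h : G.SupportedOn t) : G.upTo t = G :=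
  Multiset.filter_eq_self.2 fun e he =>
    ⟨(Finset.mem_Icc.1 (h e he).1).2, (Finset.mem_Icc.1 (h e he).2).2⟩

theorem totalDeg_eq (h : G.SupportedOn t) : totalDeg t G = 2 * Multiset.card G := by
  have hfst : ∑ v ∈ Finset.Icc 1 t, (G.map Prod.fst).count v = Multiset.card G := by
    rw [Multiset.sum_count_eq_card (by simpa using fun v w hvw => (h (v, w) hvw).1),
      Multiset.card_map]
  have hsnd : ∑ v ∈ Finset.Icc 1 t, (G.map Prod.snd).count v = Multiset.card G := by
    rw [Multiset.sum_count_eq_card (by simpa using fun v w hvw => (h (w, v) hvw).2),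
      Multiset.card_map]
  simp only [totalDeg, deg, Finset.sum_add_distrib, hfst, hsnd]
  omega

theorem deg_eq_zero (h : G.SupportedOn t) (ha : t < a) : G.deg a = 0 := by
  simp only [deg, Nat.add_eq_zero_iff, Multiset.count_eq_zero, Multiset.mem_map, not_exists,
    not_and]
  refine ⟨fun e he hea => ?_, fun e he hea => ?_⟩
  · exact ha.not_ge (hea ▸ (Finset.mem_Icc.1 (h e he).1).2)
  · exact ha.not_ge (hea ▸ (Finset.mem_Icc.1 (h e he).2).2)

theorem not_adjacent (h : G.SupportedOn t) (ha : t < a) : ¬ G.Adjacent u a := by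
  rintro (he | he)
  · exact ha.not_ge (Finset.mem_Icc.1 (h _ he).2).2
  · exact ha.not_ge (Finset.mem_Icc.1 (h _ he).1).2

end SupportedOn

theorem mem_Icc_of_mem_support_endpoint {u : ℕ} {hu : 1 ≤ u} {G : PAGraph} {v : ℕ}
    (h : v ∈ (endpoint u hu G).support) : v ∈ Finset.Icc 1 u :=
  ((PMF.mem_support_ofFinset_iff _ _ _).1 h).1

theorem endpoint_apply {u : ℕ} (hu : 1 ≤ u) (G : PAGraph) (v : ℕ) :
    endpoint u hu G v = endpointProb u G v := rfl

theorem endpoint_apply_of_lt {u a : ℕ} (hu : 1 ≤ u) {G : PAGraph} (hG : G.SupportedOn u)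
    (ha : 1 ≤ a) (hau : a < u) :
    endpoint u hu G a = (G.deg a : ℝ≥0∞) / ((2 * Multiset.card G + 1 : ℕ) : ℝ≥0∞) := by
  rw [endpoint_apply, endpointProb, if_pos (Finset.mem_Icc.2 ⟨ha, hau.le⟩),
    if_neg hau.ne, add_zero, hG.totalDeg_eq]

theorem endpoint_one (G : PAGraph) : endpoint 1 le_rfl G = PMF.pure 1 := by
  have hone : endpoint 1 le_rfl G 1 = 1 := by
    simpa [endpoint_apply] using sum_endpointProb 1 le_rfl G
  ext v
  by_cases hv : v = 1
  · simp [hv, hone]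
  · rw [PMF.pure_apply, if_neg hv, PMF.apply_eq_zero_iff, (PMF.apply_eq_one_iff _ _).1 hone]
    exact hv

theorem addEdges_one (k : ℕ) (G : PAGraph) :
    addEdges 1 le_rfl k G = PMF.pure (Multiset.replicate k (1, 1) + G) := by
  induction k generalizing G with
  | zero => simp [addEdges]
  | succ k ih => simp [addEdges, endpoint_one, ih, Multiset.replicate_succ]

theorem map_upTo_addEdges {u t : ℕ} (hu : 1 ≤ u) (h : t < u) (k : ℕ) (G : PAGraph) :
    (addEdges u hu k G).map (fun H => H.upTo t) = PMF.pure (G.upTo t) := by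
  induction k generalizing G with
  | zero => rw [addEdges, PMF.pure_map]
  | succ k ih => simp_rw [addEdges, PMF.map_bind, ih, upTo_cons_of_lt h, PMF.bind_const]

theorem upTo_eq_of_mem_support_addEdges {u t : ℕ} {hu : 1 ≤ u} {k : ℕ} {G H : PAGraph}
    (htu : t < u) (h : H ∈ (addEdges u hu k G).support) : H.upTo t = G.upTo t := by
  have hmem := (PMF.mem_support_map_iff (fun H : PAGraph => H.upTo t) _ _).2 ⟨H, h, rfl⟩
  rwa [map_upTo_addEdges hu htu, PMF.support_pure, Set.mem_singleton_iff] at hmem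

theorem exists_eq_map_mk_add_of_mem_support_addEdges {u : ℕ} {hu : 1 ≤ u} {k : ℕ} {G H : PAGraph}
    (h : H ∈ (addEdges u hu k G).support) :
    ∃ S : Multiset ℕ, Multiset.card S = k ∧ (∀ v ∈ S, v ∈ Finset.Icc 1 u) ∧
      H = S.map (Prod.mk u) + G := by
  induction k generalizing G with
  | zero =>
    rw [addEdges, PMF.support_pure, Set.mem_singleton_iff] at h
    exact ⟨0, by simp [h]⟩
  | succ k ih =>
    rw [addEdges, PMF.mem_support_bind_iff] at h
    obtain ⟨v, hv, hH⟩ := h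
    obtain ⟨S, hcard, hS, rfl⟩ := ih hH
    refine ⟨v ::ₘ S, by simp [hcard], ?_, by simp⟩
    exact Multiset.forall_mem_cons.2 ⟨mem_Icc_of_mem_support_endpoint hv, hS⟩

theorem SupportedOn.of_mem_support_addEdges {u : ℕ} {hu : 1 ≤ u} {k : ℕ} {G H : PAGraph}
    (hG : G.SupportedOn u) (h : H ∈ (addEdges u hu k G).support) : H.SupportedOn u := by
  obtain ⟨S, -, hS, rfl⟩ := exists_eq_map_mk_add_of_mem_support_addEdges h
  intro e he
  rcases Multiset.mem_add.1 he with he | he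
  · obtain ⟨v, hv, rfl⟩ := Multiset.mem_map.1 he
    exact ⟨Finset.mem_Icc.2 ⟨hu, le_rfl⟩, hS v hv⟩
  · exact hG e he

theorem deg_le_deg_of_mem_support_addEdges {u : ℕ} {hu : 1 ≤ u} {k : ℕ} {G H : PAGraph}
    (h : H ∈ (addEdges u hu k G).support) (a : ℕ) : G.deg a ≤ H.deg a := by
  obtain ⟨S, -, -, rfl⟩ := exists_eq_map_mk_add_of_mem_support_addEdges h
  exact deg_mono (Multiset.le_add_left _ _) a

theorem deg_lt_deg_of_mem_support_addEdges {u a : ℕ} {hu : 1 ≤ u} {k : ℕ} {G H : PAGraph}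
    (hau : a ≠ u) (h : H ∈ (addEdges u hu k G).support) (hG : ¬ G.Adjacent a u)
    (hH : H.Adjacent a u) : G.deg a < H.deg a := by
  obtain ⟨S, -, -, rfl⟩ := exists_eq_map_mk_add_of_mem_support_addEdges h
  have haS : a ∈ S := by
    simp only [Adjacent, Multiset.mem_add, Multiset.mem_map, Prod.mk.injEq] at hG hH
    grind
  rw [deg_add, deg_map_mk_of_ne hau.symm]
  exact Nat.lt_add_of_pos_left (Multiset.count_pos.2 haS)

theorem law_succ (m n : ℕ) :
    law m (n + 1) = (law m n).bind fun G => addEdges (n + 1) (Nat.le_add_left 1 n) m G := by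
  cases n with
  | zero => simp [law, addEdges_one]
  | succ n => rfl

theorem card_eq_and_supportedOn_of_mem_support_law {m t : ℕ} {G : PAGraph}
    (h : G ∈ (law m t).support) : Multiset.card G = m * t ∧ G.SupportedOn t := by
  induction t generalizing G with
  | zero =>
    rw [law, PMF.support_pure, Set.mem_singleton_iff] at h
    simp [h, SupportedOn]
  | succ t ih =>
    rw [law_succ, PMF.mem_support_bind_iff] at h
    obtain ⟨K, hK, hG⟩ := h
    obtain ⟨hcard, hsupp⟩ := ih hK
    refine ⟨?_, (hsupp.mono t.le_succ).of_mem_support_addEdges hG⟩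
    obtain ⟨S, hS, -, rfl⟩ := exists_eq_map_mk_add_of_mem_support_addEdges hG
    rw [Multiset.card_add, Multiset.card_map, hS, hcard, mul_add_one, add_comm]

theorem map_upTo_law (m : ℕ) {t n : ℕ} (htn : t ≤ n) :
    (law m n).map (fun G => G.upTo t) = law m t := by
  induction n, htn using Nat.le_induction with
  | base =>
    refine (map_congr_of_mem_support fun G hG => ?_).trans (law m t).map_id
    exact (card_eq_and_supportedOn_of_mem_support_law hG).2.upTo_eq
  | succ n hn ih =>
    simp_rw [law_succ, PMF.map_bind, map_upTo_addEdges _ (Nat.lt_succ_of_le hn), ← ih]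
    rfl

theorem upTo_mem_support_law {m t n : ℕ} {G : PAGraph} (hG : G ∈ (law m n).support)
    (htn : t ≤ n) : G.upTo t ∈ (law m t).support := by
  rw [← map_upTo_law m htn]
  exact (PMF.mem_support_map_iff ..).2 ⟨G, hG, rfl⟩

theorem lintegral_ascFactorial_deg_endpoint {u a : ℕ} (hu : 1 ≤ u) {G : PAGraph}
    (hG : G.SupportedOn u) (ha : 1 ≤ a) (hau : a < u) (k : ℕ) :
    ∫⁻ v, ((deg ((u, v) ::ₘ G) a).ascFactorial k : ℝ≥0∞) ∂(endpoint u hu G).toMeasure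
      = (G.deg a).ascFactorial k * (1 + k / (2 * Multiset.card G + 1 : ℕ)) := by
  obtain ⟨d, hd, hdeg⟩ := exists_ascFactorial_add_one_eq (G.deg a) k
  have hstep (v : ℕ) : ((deg ((u, v) ::ₘ G) a).ascFactorial k : ℝ≥0∞)
      = (G.deg a).ascFactorial k + if v = a then (d : ℝ≥0∞) else 0 := by
    rw [deg_cons_of_ne hau.ne']
    split_ifs with hv
    · rw [hd, Nat.cast_add]
    · simp
  calc
    _ = (G.deg a).ascFactorial k + endpoint u hu G a * d := by
      simp_rw [hstep]
      rw [lintegral_add_left measurable_const, lintegral_const, measure_univ, mul_one,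
        lintegral_toMeasure, tsum_eq_single a fun v hv => by rw [if_neg hv, mul_zero], if_pos rfl]
    _ = _ := by
      rw [endpoint_apply_of_lt hu hG ha hau, mul_one_add, ENNReal.mul_comm_div, ← mul_div_assoc,
        ← mul_div_assoc]
      norm_cast
      rw [hdeg, mul_comm]

theorem lintegral_ascFactorial_deg_addEdges_le {u a : ℕ} (hu : 1 ≤ u) {G : PAGraph}
    (hG : G.SupportedOn u) (ha : 1 ≤ a) (hau : a < u) (k l : ℕ) :
    ∫⁻ H, ((H.deg a).ascFactorial k : ℝ≥0∞) ∂(addEdges u hu l G).toMeasure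
      ≤ (G.deg a).ascFactorial k * (((Multiset.card G + l : ℕ) : ℝ≥0∞) / Multiset.card G) ^ k := by
  induction l generalizing G with
  | zero =>
    rw [addEdges, PMF.toMeasure_pure, lintegral_dirac, add_zero]
    rcases eq_or_ne (Multiset.card G) 0 with hcard | hcard
    · -- Here the ratio is `0 / 0 = 0`, but the degree vanishes as well.
      obtain rfl := Multiset.card_eq_zero.1 hcard
      cases k <;> simp [deg, Nat.zero_ascFactorial]
    · rw [ENNReal.div_self (Nat.cast_ne_zero.2 hcard) (by simp), one_pow, mul_one]
  | succ l ih =>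
    rw [addEdges, lintegral_toMeasure_bind]
    calc
      _ ≤ ∫⁻ v, (deg ((u, v) ::ₘ G) a).ascFactorial k *
            (((Multiset.card G + (l + 1) : ℕ) : ℝ≥0∞) / (Multiset.card G + 1 : ℕ)) ^ k
              ∂(endpoint u hu G).toMeasure := by
        refine lintegral_mono_ae ?_
        filter_upwards [ae_toMeasure_mem_support (endpoint u hu G)] with v hv
        have hGv : SupportedOn u ((u, v) ::ₘ G) :=
          hG.cons (Finset.mem_Icc.2 ⟨hu, le_rfl⟩) (mem_Icc_of_mem_support_endpoint hv)
        refine (ih hGv).trans_eq ?_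
        rw [Multiset.card_cons, add_right_comm, add_assoc]
      _ = (G.deg a).ascFactorial k * (1 + k / (2 * Multiset.card G + 1 : ℕ)) *
            (((Multiset.card G + (l + 1) : ℕ) : ℝ≥0∞) / (Multiset.card G + 1 : ℕ)) ^ k := by
        rw [lintegral_mul_const _ .of_discrete, lintegral_ascFactorial_deg_endpoint hu hG ha hau]
      _ ≤ (G.deg a).ascFactorial k * (((Multiset.card G + 1 : ℕ) : ℝ≥0∞) / Multiset.card G) ^ k *
            (((Multiset.card G + (l + 1) : ℕ) : ℝ≥0∞) / (Multiset.card G + 1 : ℕ)) ^ k := by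
        gcongr
        exact one_add_div_le_pow _ k
      _ = _ := by
        rw [mul_assoc, ← mul_pow, mul_comm (_ / _), div_mul_div_cancel_natCast (by omega)]

theorem toMeasure_addEdges_adjacent_le {u a : ℕ} (hu : 1 ≤ u) {G : PAGraph}
    (hG : G.SupportedOn u) (ha : 1 ≤ a) (hau : a < u) (hadj : ¬ G.Adjacent a u) (k : ℕ) :
    (addEdges u hu k G).toMeasure {H | H.Adjacent a u} ≤ G.deg a * (k / Multiset.card G) := by
  set μ := (addEdges u hu k G).toMeasure
  set E : Set PAGraph := {H | H.Adjacent a u}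
  have hincrease : ∀ᵐ H ∂μ, G.deg a + E.indicator 1 H ≤ (H.deg a : ℝ≥0∞) := by
    filter_upwards [ae_toMeasure_mem_support (addEdges u hu k G)] with H hH
    by_cases hHE : H ∈ E
    · rw [Set.indicator_of_mem hHE, Pi.one_apply]
      exact_mod_cast deg_lt_deg_of_mem_support_addEdges hau.ne hH hadj hHE
    · rw [Set.indicator_of_notMem hHE, add_zero]
      exact_mod_cast deg_le_deg_of_mem_support_addEdges hH a
  refine (ENNReal.add_le_add_iff_left (ENNReal.natCast_ne_top (G.deg a))).1 ?_
  calc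
    (G.deg a : ℝ≥0∞) + μ E = ∫⁻ H, (G.deg a + E.indicator 1 H) ∂μ := by
      rw [lintegral_add_left measurable_const, lintegral_const, measure_univ, mul_one,
        lintegral_indicator_one .of_discrete]
    _ ≤ ∫⁻ H, (H.deg a : ℝ≥0∞) ∂μ := lintegral_mono_ae hincrease
    _ ≤ G.deg a * (((Multiset.card G + k : ℕ) : ℝ≥0∞) / Multiset.card G) := by
      simpa [Nat.ascFactorial_succ] using
        lintegral_ascFactorial_deg_addEdges_le hu hG ha hau 1 k
    _ ≤ G.deg a * (1 + k / Multiset.card G) := by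
      rw [Nat.cast_add, ENNReal.add_div]
      gcongr
      exact ENNReal.div_self_le_one
    _ = G.deg a + G.deg a * (k / Multiset.card G) := mul_one_add _ _

theorem arrivalProb_comm (m n : ℕ) (G : PAGraph) (u v : ℕ) :
    arrivalProb m n G u v = arrivalProb m n G v u := by
  simp_rw [arrivalProb, max_comm u, adjacent_comm _ u]

theorem arrivalProb_eq_addEdges {m n t u : ℕ} {G : PAGraph} (hG : G ∈ (law m n).support)
    (hut : u ≤ t) (htn : t < n) :
    arrivalProb m n G u (t + 1) =
      (addEdges (t + 1) (Nat.le_add_left 1 t) m (G.upTo t)).toMeasure.real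
        {H | H.Adjacent u (t + 1)} := by
  have hpast : ∀ K ∈ (law m t).support,
      ∀ H ∈ (addEdges (t + 1) (Nat.le_add_left 1 t) m K).support, H.upTo t = K := fun K hK H hH =>
    (upTo_eq_of_mem_support_addEdges t.lt_succ_self hH).trans
      (card_eq_and_supportedOn_of_mem_support_law hK).2.upTo_eq
  have hut' : u ≤ t + 1 := hut.trans t.le_succ
  have hevent : {H : PAGraph | H.Adjacent u (t + 1)}
      = (fun H => H.upTo (t + 1)) ⁻¹' {H | H.Adjacent u (t + 1)} :=
    Set.ext fun H => (adjacent_upTo H hut' le_rfl).symm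
  have hcondition : {H : PAGraph | H.upTo t = G.upTo t}
      = (fun H => H.upTo (t + 1)) ⁻¹' ((fun H => H.upTo t) ⁻¹' {G.upTo t}) :=
    Set.ext fun H => by
      rw [Set.mem_preimage, Set.mem_preimage, upTo_upTo H t.le_succ]
      rfl
  rw [arrivalProb, max_eq_right hut', Nat.add_sub_cancel, measureReal_def, hcondition]
  nth_rw 1 [hevent]
  rw [cond_preimage_apply _ .of_discrete .of_discrete .of_discrete,
    PMF.toMeasure_map _ _ .of_discrete, map_upTo_law m htn, law_succ,
    cond_toMeasure_bind hpast (upTo_mem_support_law hG htn.le), measureReal_def]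

theorem arrivalProb_le {m n t u : ℕ} {G : PAGraph} (hG : G ∈ (law m n).support)
    (hu : 1 ≤ u) (hut : u ≤ t) (htn : t < n) :
    arrivalProb m n G u (t + 1) ≤ ((G.upTo t).deg u : ℝ) / t := by
  obtain ⟨hcard, hsupp⟩ :=
    card_eq_and_supportedOn_of_mem_support_law (upTo_mem_support_law hG htn.le)
  have hle : (addEdges (t + 1) (Nat.le_add_left 1 t) m (G.upTo t)).toMeasure
      {H | H.Adjacent u (t + 1)} ≤ ((G.upTo t).deg u : ℝ≥0∞) / t := by
    calc
      _ ≤ (G.upTo t).deg u * ((m : ℝ≥0∞) / Multiset.card (G.upTo t)) :=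
        toMeasure_addEdges_adjacent_le _ (hsupp.mono t.le_succ) hu (Nat.lt_succ_of_le hut)
          (hsupp.not_adjacent t.lt_succ_self) m
      _ ≤ (G.upTo t).deg u * (1 / t) := by
        rw [hcard]
        gcongr _ * ?_
        simpa only [mul_one, Nat.cast_one] using natCast_mul_div_mul_left_le m 1 t
      _ = _ := by rw [mul_one_div]
  rw [arrivalProb_eq_addEdges hG hut htn, measureReal_def]
  refine (ENNReal.toReal_mono ?_ hle).trans_eq (by simp)
  exact ENNReal.div_ne_top (by simp) (by norm_cast; omega)

theorem deg_self_le_of_mem_support_law_succ {m n : ℕ} {G : PAGraph}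
    (h : G ∈ (law m (n + 1)).support) : G.deg (n + 1) ≤ 2 * m := by
  rw [law_succ, PMF.mem_support_bind_iff] at h
  obtain ⟨K, hK, hG⟩ := h
  obtain ⟨S, hS, -, rfl⟩ := exists_eq_map_mk_add_of_mem_support_addEdges hG
  rw [deg_add, (card_eq_and_supportedOn_of_mem_support_law hK).2.deg_eq_zero n.lt_succ_self,
    add_zero]
  simpa [hS] using deg_le_two_mul_card (S.map (Prod.mk (n + 1))) (n + 1)

theorem lintegral_ascFactorial_deg_law_le {m i t : ℕ} (hi : 1 ≤ i) (hit : i ≤ t) (k : ℕ) :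
    ∫⁻ G, ((G.deg i).ascFactorial k : ℝ≥0∞) ∂(law m t).toMeasure
      ≤ (2 * m).ascFactorial k * ((t : ℝ≥0∞) / i) ^ k := by
  induction t, hit using Nat.le_induction with
  | base =>
    obtain ⟨n, rfl⟩ := Nat.exists_eq_add_of_le' hi
    calc
      ∫⁻ G, ((G.deg (n + 1)).ascFactorial k : ℝ≥0∞) ∂(law m (n + 1)).toMeasure
        ≤ ∫⁻ _, ((2 * m).ascFactorial k : ℝ≥0∞) ∂(law m (n + 1)).toMeasure := by
          refine lintegral_mono_ae ?_
          filter_upwards [ae_toMeasure_mem_support (law m (n + 1))] with G hG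
          exact_mod_cast Nat.ascFactorial_le k (deg_self_le_of_mem_support_law_succ hG)
      _ = _ := by
        rw [lintegral_const, measure_univ, ENNReal.div_self (by simp) (by simp), one_pow]
  | succ t hit ih =>
    rw [law_succ, lintegral_toMeasure_bind]
    calc
      _ ≤ ∫⁻ G, (G.deg i).ascFactorial k * (((t + 1 : ℕ) : ℝ≥0∞) / t) ^ k ∂(law m t).toMeasure := by
        refine lintegral_mono_ae ?_
        filter_upwards [ae_toMeasure_mem_support (law m t)] with G hG
        obtain ⟨hcard, hsupp⟩ := card_eq_and_supportedOn_of_mem_support_law hG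
        refine (lintegral_ascFactorial_deg_addEdges_le _ (hsupp.mono t.le_succ) hi
          (Nat.lt_succ_of_le hit) k m).trans ?_
        gcongr _ * ?_ ^ k
        rw [hcard, ← mul_add_one]
        exact natCast_mul_div_mul_left_le m (t + 1) t
      _ ≤ (2 * m).ascFactorial k * ((t : ℝ≥0∞) / i) ^ k * (((t + 1 : ℕ) : ℝ≥0∞) / t) ^ k := by
        rw [lintegral_mul_const _ .of_discrete]
        gcongr
      _ = _ := by
        rw [mul_assoc, ← mul_pow, mul_comm (_ / _), div_mul_div_cancel_natCast (by omega)]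

theorem pow_mul_toMeasure_law_lt_deg_le {m i t : ℕ} (hi : 1 ≤ i) (hit : i ≤ t) (k : ℕ)
    (x : ℝ≥0∞) :
    x ^ k * (law m t).toMeasure {G | x < G.deg i}
      ≤ (((2 * m + k : ℕ) : ℝ≥0∞) * ((t : ℝ≥0∞) / i)) ^ k := by
  have hpow {G : PAGraph} (hG : x < G.deg i) : x ^ k ≤ ((G.deg i).ascFactorial k : ℝ≥0∞) :=
    calc
      x ^ k ≤ (G.deg i : ℝ≥0∞) ^ k := by gcongr
      _ ≤ (G.deg i).ascFactorial k := by exact_mod_cast Nat.pow_succ_le_ascFactorial (G.deg i) k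
  have hbase : ((2 * m).ascFactorial k : ℝ≥0∞) ≤ ((2 * m + k : ℕ) : ℝ≥0∞) ^ k := by
    exact_mod_cast (Nat.ascFactorial_le k (2 * m).le_succ).trans (Nat.ascFactorial_le_pow_add _ k)
  calc
    _ ≤ x ^ k * (law m t).toMeasure {G | x ^ k ≤ ((G.deg i).ascFactorial k : ℝ≥0∞)} := by
      gcongr
      exact fun hG => hpow hG
    _ ≤ ∫⁻ G, ((G.deg i).ascFactorial k : ℝ≥0∞) ∂(law m t).toMeasure :=
      mul_meas_ge_le_lintegral .of_discrete _
    _ ≤ (2 * m).ascFactorial k * ((t : ℝ≥0∞) / i) ^ k :=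
      lintegral_ascFactorial_deg_law_le hi hit k
    _ ≤ _ := by
      rw [mul_pow]
      gcongr

theorem toMeasure_law_lt_deg_le {m i t : ℕ} (hi : 1 ≤ i) (hit : i ≤ t) (k : ℕ) {L : ℝ}
    (hL : 0 < L) :
    (law m t).toMeasure {G | (t : ℝ) / i * L < G.deg i}
      ≤ ENNReal.ofReal ((((2 * m + k : ℕ) : ℝ) / L) ^ k) := by
  have hi' : (0 : ℝ) < i := by exact_mod_cast hi
  have hratio : (0 : ℝ) < (t : ℝ) / i := div_pos (hi'.trans_le (by exact_mod_cast hit)) hi'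
  have hcast : ((2 * m + k : ℕ) : ℝ≥0∞) * ((t : ℝ≥0∞) / i)
      = ENNReal.ofReal ((2 * m + k : ℕ) * ((t : ℝ) / i)) := by
    rw [ENNReal.ofReal_mul (by positivity), ENNReal.ofReal_div_of_pos hi']
    simp_rw [ENNReal.ofReal_natCast]
  have hpos : 0 < (t : ℝ) / i * L := mul_pos hratio hL
  have hevent : {G : PAGraph | (t : ℝ) / i * L < G.deg i}
      = {G | ENNReal.ofReal ((t : ℝ) / i * L) < G.deg i} := by
    ext G
    rw [Set.mem_ofPred_eq, Set.mem_ofPred_eq, ← ENNReal.ofReal_natCast,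
      ENNReal.ofReal_lt_ofReal_iff_of_nonneg hpos.le]
  have hmarkov := pow_mul_toMeasure_law_lt_deg_le (m := m) hi hit k
    (ENNReal.ofReal ((t : ℝ) / i * L))
  rw [hcast, ← hevent, mul_comm, ← ENNReal.ofReal_pow hpos.le,
    ← ENNReal.le_div_iff_mul_le (.inl (ENNReal.ofReal_pos.2 (pow_pos hpos k)).ne')
      (.inl ENNReal.ofReal_ne_top),
    ← ENNReal.ofReal_pow (by positivity), ← ENNReal.ofReal_div_of_pos (pow_pos hpos k),
    ← div_pow, mul_comm _ ((t : ℝ) / i), mul_div_mul_left _ _ hratio.ne'] at hmarkov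
  exact hmarkov

/-- The graphs in which, for some `2 ≤ i ≤ t ≤ n`, the degree of the node `i` after `t` steps
exceeds `L` times `t / i`. Degrees are typically of order `√(t / i)`; the cruder `t / i` suffices
because `t` cancels in the bound `deg i / t` on the probability of an edge to `i`. -/
def highDegree (L : ℝ) (n : ℕ) : Set PAGraph :=
  ⋃ i ∈ Finset.Icc 2 n, ⋃ t ∈ Finset.Icc i n, {G | (t : ℝ) / i * L < (G.upTo t).deg i}

theorem toMeasure_law_highDegree_le (m n k : ℕ) {L : ℝ} (hL : 0 < L) :
    (law m n).toMeasure (highDegree L n)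
      ≤ n ^ 2 * ENNReal.ofReal ((((2 * m + k : ℕ) : ℝ) / L) ^ k) := by
  set ε := ENNReal.ofReal ((((2 * m + k : ℕ) : ℝ) / L) ^ k)
  have hevent : ∀ i ∈ Finset.Icc 2 n, ∀ t ∈ Finset.Icc i n,
      (law m n).toMeasure {G | (t : ℝ) / i * L < (G.upTo t).deg i} ≤ ε := by
    intro i hi t ht
    rw [Finset.mem_Icc] at hi ht
    have hbound := toMeasure_law_lt_deg_le (m := m) (one_le_two.trans hi.1) ht.1 k hL
    rw [← map_upTo_law m ht.2, PMF.toMeasure_map_apply _ _ _ .of_discrete .of_discrete] at hbound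
    exact hbound
  calc
    (law m n).toMeasure (highDegree L n)
      ≤ ∑ i ∈ Finset.Icc 2 n, ∑ t ∈ Finset.Icc i n,
          (law m n).toMeasure {G | (t : ℝ) / i * L < (G.upTo t).deg i} :=
        (measure_biUnion_finset_le _ _).trans
          (Finset.sum_le_sum fun i _ => measure_biUnion_finset_le _ _)
    _ ≤ ∑ i ∈ Finset.Icc 2 n, ∑ _t ∈ Finset.Icc i n, ε :=
      Finset.sum_le_sum fun i hi => Finset.sum_le_sum (hevent i hi)
    _ ≤ ∑ _i ∈ Finset.Icc 2 n, ∑ _t ∈ Finset.Icc 1 n, ε :=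
      Finset.sum_le_sum fun i hi => Finset.sum_le_sum_of_subset <|
        Finset.Icc_subset_Icc_left (one_le_two.trans (Finset.mem_Icc.1 hi).1)
    _ ≤ ∑ _i ∈ Finset.Icc 1 n, ∑ _t ∈ Finset.Icc 1 n, ε :=
      Finset.sum_le_sum_of_subset (Finset.Icc_subset_Icc_left one_le_two)
    _ = n ^ 2 * ε := by simp [sq, mul_assoc]

theorem arrivalProb_le_of_lt {m n u i s : ℕ} {G : PAGraph} (hG : G ∈ (law m n).support)
    (hu : 1 ≤ u) (hui : u < i) (hin : i ≤ n) (his : i - 1 ≤ s) :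
    arrivalProb m n G u i ≤ ((G.upTo s).deg u : ℝ) / ((i : ℝ) - 1) := by
  obtain ⟨t, rfl⟩ := Nat.exists_eq_add_of_le' (hu.trans hui.le)
  refine (arrivalProb_le hG hu (Nat.lt_succ_iff.1 hui) hin).trans ?_
  rw [Nat.cast_add_one, add_sub_cancel_right]
  gcongr
  exact deg_mono (upTo_mono G his) u

theorem arrivalProb_le_of_gt {m n u i : ℕ} {L : ℝ} {G : PAGraph} (hG : G ∈ (law m n).support)
    (hL : 0 ≤ L) (hGL : G ∉ highDegree L n) (hi : 2 ≤ i) (hiu : i < u) (hun : u ≤ n) :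
    arrivalProb m n G u i ≤ L / ((i : ℝ) - 1) := by
  obtain ⟨t, rfl⟩ := Nat.exists_eq_add_of_le' (one_le_two.trans (hi.trans hiu.le))
  have hit : i ≤ t := Nat.lt_succ_iff.1 hiu
  have hdeg : ((G.upTo t).deg i : ℝ) ≤ (t : ℝ) / i * L := by
    simp only [highDegree, Set.mem_iUnion, not_exists, Set.mem_ofPred_eq, not_lt] at hGL
    exact hGL i (Finset.mem_Icc.2 ⟨hi, by omega⟩) t (Finset.mem_Icc.2 ⟨hit, by omega⟩)
  have hi' : (2 : ℝ) ≤ i := by exact_mod_cast hi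
  have ht : (0 : ℝ) < t := by exact_mod_cast (by omega : 0 < t)
  calc
    arrivalProb m n G (t + 1) i = arrivalProb m n G i (t + 1) := arrivalProb_comm ..
    _ ≤ ((G.upTo t).deg i : ℝ) / t := arrivalProb_le hG (one_le_two.trans hi) hit hun
    _ ≤ (t : ℝ) / i * L / t := by gcongr
    _ = L / i := by field_simp
    _ ≤ L / ((i : ℝ) - 1) := by
      gcongr
      · linarith
      · linarith

theorem arrivalProb_le_max_div {m n u i s : ℕ} {L : ℝ} {G : PAGraph}
    (hG : G ∈ (law m n).support) (hL : 0 ≤ L) (hGL : G ∉ highDegree L n) (hu : 1 ≤ u ∧ u ≤ n)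
    (hi : 2 ≤ i ∧ i ≤ n) (hui : u ≠ i) (his : i - 1 ≤ s) :
    arrivalProb m n G u i ≤ max ((G.upTo s).deg u : ℝ) L / ((i : ℝ) - 1) := by
  have hi' : (0 : ℝ) ≤ i - 1 := sub_nonneg.2 (by exact_mod_cast one_le_two.trans hi.1)
  rcases hui.lt_or_gt with hlt | hgt
  · refine (arrivalProb_le_of_lt hG hu.1 hlt hi.2 his).trans ?_
    gcongr
    exact le_max_left _ _
  · refine (arrivalProb_le_of_gt hG hL hGL hi.1 hgt hu.2).trans ?_
    gcongr
    exact le_max_right _ _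

theorem eventually_toMeasure_law_highDegree_le (m : ℕ) {L : ℕ → ℝ}
    (hL : ∀ᶠ n : ℕ in atTop, 2 * Real.exp 3 * Real.log n ≤ L n) :
    ∀ᶠ n : ℕ in atTop, (law m n).toMeasure (highDegree (L n) n) ≤ (n : ℝ≥0∞)⁻¹ := by
  filter_upwards [hL, tendsto_log_natCast_atTop.eventually_ge_atTop (2 * m + 1),
    eventually_gt_atTop 0] with n hLn hlogn hn
  set k := ⌈Real.log n⌉₊
  have hlogpos : 0 < Real.log n := lt_of_lt_of_le (by positivity) hlogn
  have hLpos : 0 < L n := lt_of_lt_of_le (by positivity) hLn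
  have hbase : ((2 * m + k : ℕ) : ℝ) ≤ 2 * Real.log n := by
    have hceil : (k : ℝ) < Real.log n + 1 := Nat.ceil_lt_add_one hlogpos.le
    push_cast
    linarith
  have hratio : ((2 * m + k : ℕ) : ℝ) / L n ≤ Real.exp (-3) := by
    rw [div_le_iff₀ hLpos]
    calc
      ((2 * m + k : ℕ) : ℝ) ≤ Real.exp (-3) * (2 * Real.exp 3 * Real.log n) := by
        refine hbase.trans_eq ?_
        rw [Real.exp_neg]
        field_simp
      _ ≤ Real.exp (-3) * L n := by gcongr
  calc
    _ ≤ n ^ 2 * ENNReal.ofReal ((((2 * m + k : ℕ) : ℝ) / L n) ^ k) :=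
      toMeasure_law_highDegree_le m n k hLpos
    _ ≤ n ^ 2 * ENNReal.ofReal ((n : ℝ) ^ (-3 : ℝ)) := by
      gcongr
      exact pow_ceil_log_le_rpow_neg (by positivity) (by positivity) (by norm_num) hratio
    _ = (n : ℝ≥0∞)⁻¹ := by
      rw [← ENNReal.ofReal_natCast, ← ENNReal.ofReal_pow (by positivity),
        ← ENNReal.ofReal_mul (by positivity), ← ENNReal.ofReal_inv_of_pos (by positivity)]
      congr 1
      rw [← Real.rpow_natCast, ← Real.rpow_add (by positivity), ← Real.rpow_neg_one]
      norm_num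

end PAGraph

theorem mainTheorem10_general (m : ℕ) (L : ℕ → ℝ)
    (hL : ∀ᶠ n : ℕ in atTop, 2 * Real.exp 3 * Real.log n ≤ L n) :
    Tendsto
      (fun n : ℕ => (PAGraph.law m n).toMeasure
        {G : PAGraph | ∀ u ∈ Finset.Icc 1 n, ∀ i ∈ Finset.Icc 2 n, u ≠ i →
          ∀ s ∈ Finset.Icc (max u (i - 1)) n,
            PAGraph.arrivalProb m n G u i
              ≤ max ((G.upTo s).deg u : ℝ) (L n) / ((i : ℝ) - 1)})
      atTop (𝓝 1) := by
  have hlimit : Tendsto (fun n : ℕ => 1 - (n : ℝ≥0∞)⁻¹) atTop (𝓝 1) := by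
    simpa using ENNReal.Tendsto.sub tendsto_const_nhds ENNReal.tendsto_inv_nat_nhds_zero
      (.inl ENNReal.one_ne_top)
  refine tendsto_of_tendsto_of_tendsto_of_le_of_le' hlimit tendsto_const_nhds ?_
    (.of_forall fun n => prob_le_one)
  filter_upwards [PAGraph.eventually_toMeasure_law_highDegree_le m hL, hL] with n hsmall hLn
  have hLpos : 0 ≤ L n := hLn.trans' (by positivity)
  calc
    1 - (n : ℝ≥0∞)⁻¹ ≤ (PAGraph.law m n).toMeasure (PAGraph.highDegree (L n) n)ᶜ := by
      rw [prob_compl_eq_one_sub .of_discrete]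
      gcongr
    _ ≤ _ := measure_mono_ae ?_
  filter_upwards [ae_toMeasure_mem_support (PAGraph.law m n)] with G hG hGL u hu i hi hui s hs
  rw [Finset.mem_Icc] at hu hi hs
  exact PAGraph.arrivalProb_le_max_div hG hLpos hGL hu hi hui (le_of_max_le_right hs.1)

theorem mainTheorem10 (m : ℕ) (hm : 1 ≤ m) :
    Tendsto
      (fun n : ℕ => (PAGraph.law m n).toMeasure
        {G : PAGraph | ∀ u ∈ Finset.Icc 1 n, ∀ i ∈ Finset.Icc 2 n, u ≠ i →
          ∀ s ∈ Finset.Icc (max u (i - 1)) n,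
            PAGraph.arrivalProb m n G u i
              ≤ max ((G.upTo s).deg u : ℝ) (Real.log n ^ 3) / ((i : ℝ) - 1)})
      atTop (𝓝 1) :=
  mainTheorem10_general m _ (eventually_mul_log_le_log_pow_three _)
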